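/- **Theorem 2.2.** Let $q_0>0$, let $q_\pm\in\mathbb{C}$ with $|q_\pm|=q_0$, fix $t\in\mathbb{R}$, and let $q(\cdot,t):\mathbb{R}\to\mathbb{C}$ satisfy $q(\cdot,t)-q_-\in L^1(-\infty,0]$ and $q(\cdot,t)-q_+\in L^1[0,\infty)$. For $z\in\mathbb{C}\setminus\{0,\pm iq_0\}$ put $$\lambda(z)=\tfrac12\Big(z+\frac{q_0^2}{z}\Big),\quad Y_\pm(z)=\begin{pmatrix}1&-iq_\pm/z\\-iq_\pm^*/z&1\end{pmatrix},\quad \Delta Q_\pm(y,t)=\begin{pmatrix}0&q(y,t)-q_\pm\\-(q(y,t)-q_\pm)^*&0\end{pmatrix},$$ $\sigma_3=\mathrm{diag}(1,-1)$ and $e^{a\hat\sigma_3}A=e^{a\sigma_3}Ae^{-a\sigma_3}$. The modified Jost eigenfunctions $\mu_\pm(x,t;z)$ are defined, column by column, by the Volterra integral equations $$\mu_-(x,t;z)=Y_-+\int_{-\infty}^xY_-e^{-i\lambda(x-y)\hat\sigma_3}\big[Y_-^{-1}\Delta Q_-(y,t)\mu_-(y,t;z)\big]\,dy,$$ $$\mu_+(x,t;z)=Y_+-\int_x^{\infty}Y_+e^{-i\lambda(x-y)\hat\sigma_3}\big[Y_+^{-1}\Delta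 Q_+(y,t)\mu_+(y,t;z)\big]\,dy$$ (absolutely convergent integrals; columns continuous in $x\in\mathbb{R}$) together with the normalization $\mu_\pm\to Y_\pm$ as $x\to\pm\infty$; the $j$-th column $\mu_{\pm,j}$ satisfies an equation that does not involve the other column. Let $$D_+=\{z\in\mathbb{C}:(|z|^2-q_0^2)\,\mathrm{Im}\,z>0\},\qquad D_-=\{z\in\mathbb{C}:(|z|^2-q_0^2)\,\mathrm{Im}\,z<0\},$$ $$\Sigma_0=\big(\mathbb{R}\cup\{|z|=q_0\}\big)\setminus\{0,\pm iq_0\}.$$ Then the columns $\mu_{-,1}$ and $\mu_{+,2}$ exist and are unique for every $z\in D_+\cup\Sigma_0$, and the columns $\mu_{-,2}$ and $\mu_{+,1}$ exist and are unique for every $z\in D_-\cup\Sigma_0$. Moreover, for every $x\in\mathbb{R}$, $\mu_{-,1}(x,t;\cdot)$ and $\mu_{+,2}(x,t;\cdot)$ are analytic in $D_+$, and $\mu_{-,2}(x,t;\cdot)$ and $\mu_{+,1}(x,t;\cdot)$ are analytic in $D_-$. -/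

import Mathlib

open Filter Topology MeasureTheory Set

noncomputable section

namespace HDNLS

/-- The eigenvalue parameter in the uniformizing variable: `λ(z) = (z + q₀² / z) / 2`. -/
def lam (q0 : ℝ) (z : ℂ) : ℂ := (z + (q0 : ℂ) ^ 2 / z) / 2

/-- `D₊ = {z : (|z|² - q₀²) Im z > 0}`. -/
def Dplus (q0 : ℝ) : Set ℂ := {z | 0 < (‖z‖ ^ 2 - q0 ^ 2) * z.im}

/-- `D₋ = {z : (|z|² - q₀²) Im z < 0}`. -/
def Dminus (q0 : ℝ) : Set ℂ := {z | (‖z‖ ^ 2 - q0 ^ 2) * z.im < 0}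

/-- The continuous spectrum `ℝ ∪ {|z| = q₀}`, without the point `0` (where `λ` is undefined) and
the branch points `± i q₀`. -/
def Sigma0 (q0 : ℝ) : Set ℂ :=
  {z | (z.im = 0 ∨ ‖z‖ = q0) ∧ z ≠ 0 ∧ z ≠ Complex.I * q0 ∧ z ≠ -(Complex.I * q0)}

/-- The potential matrix `Q = [[0, w], [-w*, 0]]`. -/
def potential (w : ℂ) : Matrix (Fin 2) (Fin 2) ℂ :=
  !![0, w; -(starRingEnd ℂ w), 0]

/-- The eigenvector matrix `Y = [[1, -i w / z], [-i w* / z, 1]]`, where `w` is the boundary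
value `q₋` or `q₊`. -/
def eigY (w z : ℂ) : Matrix (Fin 2) (Fin 2) ℂ :=
  !![1, -(Complex.I * w / z); -(Complex.I * (starRingEnd ℂ w) / z), 1]

/-- `exp (a σ₃)` for `σ₃ = diag (1, -1)`. -/
def expSigma3 (a : ℂ) : Matrix (Fin 2) (Fin 2) ℂ :=
  !![Complex.exp a, 0; 0, Complex.exp (-a)]

/-- `exp (a σ̂₃) A = exp (a σ₃) A exp (-a σ₃)`. -/
def hatExp (a : ℂ) (A : Matrix (Fin 2) (Fin 2) ℂ) : Matrix (Fin 2) (Fin 2) ℂ :=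
  expSigma3 a * A * expSigma3 (-a)

/-- The action of `exp (a σ̂₃)` on the `j`-th column of a matrix. -/
def hatExpCol (a : ℂ) (j : Fin 2) (c : Fin 2 → ℂ) : Fin 2 → ℂ :=
  expSigma3 (-a) j j • (expSigma3 a).mulVec c

theorem hatExp_col (a : ℂ) (j : Fin 2) (A : Matrix (Fin 2) (Fin 2) ℂ) :
    (hatExp a A).col j = hatExpCol a j (A.col j) := by
  rw [Matrix.eta_fin_two A]
  ext i
  fin_cases i <;> fin_cases j <;>
    simp [hatExp, hatExpCol, expSigma3, Matrix.col, Matrix.vecHead, Matrix.vecTail] <;> ring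

/-- The integrand `Y exp (-i λ (x - y) σ̂₃) [Y⁻¹ ΔQ(y) M]` of the matrix Volterra equation, with
`ΔQ(y) = Q(y) - Q_w`; here `p` is the potential at a fixed time, `w` its boundary value and `M`
the value of the unknown matrix at `y`. -/
def integrand (p : ℝ → ℂ) (w : ℂ) (q0 : ℝ) (z : ℂ) (x y : ℝ)
    (M : Matrix (Fin 2) (Fin 2) ℂ) : Matrix (Fin 2) (Fin 2) ℂ :=
  eigY w z * hatExp (-(Complex.I * lam q0 z * ((x : ℂ) - (y : ℂ))))
    ((eigY w z)⁻¹ * (potential (p y) - potential w) * M)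

/-- The `j`-th column of the integrand; it involves only the `j`-th column `c` of the unknown
matrix (see `integrand_col`). -/
def integrandCol (p : ℝ → ℂ) (w : ℂ) (q0 : ℝ) (z : ℂ) (j : Fin 2) (x y : ℝ)
    (c : Fin 2 → ℂ) : Fin 2 → ℂ :=
  (eigY w z).mulVec (hatExpCol (-(Complex.I * lam q0 z * ((x : ℂ) - (y : ℂ)))) j
    (((eigY w z)⁻¹ * (potential (p y) - potential w)).mulVec c))

theorem integrand_col (p : ℝ → ℂ) (w : ℂ) (q0 : ℝ) (z : ℂ) (j : Fin 2) (x y : ℝ)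
    (M : Matrix (Fin 2) (Fin 2) ℂ) :
    (integrand p w q0 z x y M).col j = integrandCol p w q0 z j x y (M.col j) := by
  have h : ∀ A B : Matrix (Fin 2) (Fin 2) ℂ, (A * B).col j = A.mulVec (B.col j) :=
    fun A B => rfl
  simp only [integrand, integrandCol, h, hatExp_col]

/-- `v` is the `j`-th column of `μ₋` at the spectral parameter `z` (as a function of `x`, at a
fixed time): it is continuous, normalized by `v(x) → Y₋,ⱼ` as `x → -∞`, and solves the `j`-th
column of
`μ₋(x) = Y₋ + ∫_{-∞}^x Y₋ exp (-i λ (x - y) σ̂₃) [Y₋⁻¹ ΔQ₋(y) μ₋(y)] dy`,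
the integral being absolutely convergent. -/
structure IsMinusColumn (p : ℝ → ℂ) (w : ℂ) (q0 : ℝ) (z : ℂ) (j : Fin 2)
    (v : ℝ → Fin 2 → ℂ) : Prop where
  continuous : Continuous v
  tendsto : Tendsto v atBot (𝓝 ((eigY w z).col j))
  integrable : ∀ x : ℝ, IntegrableOn (fun y => integrandCol p w q0 z j x y (v y)) (Iic x)
  equation : ∀ x : ℝ,
    v x = (eigY w z).col j + ∫ y in Iic x, integrandCol p w q0 z j x y (v y)

/-- `v` is the `j`-th column of `μ₊` at the spectral parameter `z` (as a function of `x`, at a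
fixed time): it is continuous, normalized by `v(x) → Y₊,ⱼ` as `x → +∞`, and solves the `j`-th
column of
`μ₊(x) = Y₊ - ∫_x^∞ Y₊ exp (-i λ (x - y) σ̂₃) [Y₊⁻¹ ΔQ₊(y) μ₊(y)] dy`,
the integral being absolutely convergent. -/
structure IsPlusColumn (p : ℝ → ℂ) (w : ℂ) (q0 : ℝ) (z : ℂ) (j : Fin 2)
    (v : ℝ → Fin 2 → ℂ) : Prop where
  continuous : Continuous v
  tendsto : Tendsto v atTop (𝓝 ((eigY w z).col j))
  integrable : ∀ x : ℝ, IntegrableOn (fun y => integrandCol p w q0 z j x y (v y)) (Ici x)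
  equation : ∀ x : ℝ,
    v x = (eigY w z).col j - ∫ y in Ici x, integrandCol p w q0 z j x y (v y)

/-- The modified Jost eigenfunction `μ₋(x, t; z)`: its `j`-th column is the solution of the
`j`-th column of the Volterra equation (a default value where there is none). -/
def muMinus (q : ℝ → ℝ → ℂ) (qm : ℂ) (q0 : ℝ) (x t : ℝ) (z : ℂ) :
    Matrix (Fin 2) (Fin 2) ℂ :=
  Matrix.of fun i j =>
    Classical.epsilon (fun v => IsMinusColumn (fun y => q y t) qm q0 z j v) x i

/-- The modified Jost eigenfunction `μ₊(x, t; z)`: its `j`-th column is the solution of the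
`j`-th column of the Volterra equation (a default value where there is none). -/
def muPlus (q : ℝ → ℝ → ℂ) (qp : ℂ) (q0 : ℝ) (x t : ℝ) (z : ℂ) :
    Matrix (Fin 2) (Fin 2) ℂ :=
  Matrix.of fun i j =>
    Classical.epsilon (fun v => IsPlusColumn (fun y => q y t) qp q0 z j v) x i

end HDNLS

end

/-! Conjugating by the eigenvector matrix turns each column equation into v(x) = b + ∫_{-∞}^x a(x-y)
P(y) v(y) dy. All dependence on z sits in the kernel `a` and in `b`. For s ≥ 0 the kernel is bounded
as soon as Im λ has the sign dictated by the column (`norm_matCLM_columnExp_le`); by `lam_im` this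
sign is fixed on D₊ and on D₋, and Im λ = 0 on Σ₀.

Instead of factorial bounds on a Neumann series, a Bielecki weight φ is used
(`LeftIntegrable.exists_isWeight`): in the norm sup ‖v‖/φ the integral operator contracts by 1/2.
This gives existence by Picard iteration and uniqueness by iterating the estimate on a difference.
As P does not involve z, one weight works near any given z, so the iterates, holomorphic in z by
dominated integration, converge locally uniformly and the limit is holomorphic
(`analyticOnNhd_of_isVolterraSolution`). The reflection x ↦ -x reduces μ₊ to the same equation
(`isPlusColumn_iff`). -/

noncomputable section

namespace HDNLS

/-! ### Holomorphy under the integral sign -/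

/-- The integral of a dominated family of holomorphic functions is holomorphic. -/
theorem differentiableOn_integral_of_dominated {α E : Type*} [MeasurableSpace α]
    {μ : Measure α} [NormedAddCommGroup E] [NormedSpace ℂ E] {F : ℂ → α → E}
    {U : Set ℂ} (hU : IsOpen U) {bound : α → ℝ} (hbound : Integrable bound μ)
    (hmeas : ∀ z ∈ U, AEStronglyMeasurable (F z) μ)
    (hle : ∀ᵐ y ∂μ, ∀ z ∈ U, ‖F z y‖ ≤ bound y)
    (hd : ∀ᵐ y ∂μ, DifferentiableOn ℂ (fun z => F z y) U) :
    DifferentiableOn ℂ (fun z => ∫ y, F z y ∂μ) U := by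
  intro z₀ hz₀
  obtain ⟨s, hs, hsU⟩ := Metric.isOpen_iff.1 hU z₀ hz₀
  -- A third, so that circles of radius r around points of the r-ball stay in U: 2r < s.
  set r := s / 3 with hr
  have hr0 : 0 < r := by positivity
  have hsub : ∀ z ∈ Metric.ball z₀ r, Metric.closedBall z r ⊆ U := by
    intro z hz u hu
    apply hsU
    rw [Metric.mem_ball] at hz ⊢
    rw [Metric.mem_closedBall] at hu
    linarith [dist_triangle u z z₀]
  have hda : ∀ᵐ y ∂μ, ∀ z ∈ U, HasDerivAt (fun z => F z y) (deriv (fun z => F z y) z) z := by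
    filter_upwards [hd] with y hy z hz
    exact ((hy z hz).differentiableAt (hU.mem_nhds hz)).hasDerivAt
  have hball : Metric.ball z₀ r ⊆ U := fun z hz => hsub z hz (Metric.mem_closedBall_self hr0.le)
  refine (hasDerivAt_integral_of_dominated_loc_of_deriv_le
    (F := F) (F' := fun z y => deriv (fun z => F z y) z) (bound := fun y => bound y / r)
    (Metric.ball_mem_nhds z₀ hr0) ?_ ?_ ?_ ?_ (hbound.div_const r)
    ?_).2.differentiableAt.differentiableWithinAt
  · filter_upwards [hU.mem_nhds hz₀] with z hz using hmeas z hz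
  · exact hbound.mono' (hmeas z₀ hz₀) (hle.mono fun y hy => hy z₀ hz₀)
  -- The derivative is measurable in y as a pointwise limit of difference quotients along a
  -- sequence.
  · obtain ⟨u, hu⟩ : ∃ u : ℕ → ℂ, (∀ n, u n ≠ 0 ∧ z₀ + u n ∈ U) ∧ Tendsto u atTop (𝓝 0) := by
      have hev : ∀ᶠ t in 𝓝[≠] (0 : ℂ), t ≠ 0 ∧ z₀ + t ∈ U := by
        refine (eventually_mem_nhdsWithin).and (nhdsWithin_le_nhds ?_)
        have : Tendsto (fun t => z₀ + t) (𝓝 (0 : ℂ)) (𝓝 z₀) := by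
          have : Continuous fun t : ℂ => z₀ + t := by fun_prop
          simpa using this.tendsto 0
        exact this (hU.mem_nhds hz₀)
      obtain ⟨u, hu, hu'⟩ := exists_seq_forall_of_frequently hev.frequently
      exact ⟨u, hu', hu.mono_right nhdsWithin_le_nhds⟩
    refine aestronglyMeasurable_of_tendsto_ae atTop
      (f := fun n y => (u n)⁻¹ • (F (z₀ + u n) y - F z₀ y)) (fun n => ?_) ?_
    · exact ((hmeas _ (hu.1 n).2).sub (hmeas z₀ hz₀)).const_smul _
    · filter_upwards [hda] with y hy
      refine (hasDerivAt_iff_tendsto_slope_zero.1 (hy z₀ hz₀)).comp ?_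
      exact tendsto_nhdsWithin_iff.2 ⟨hu.2, Eventually.of_forall fun n => (hu.1 n).1⟩
  -- Cauchy's estimate on a circle of radius r supplies the integrable bound on the derivative.
  · filter_upwards [hle, hd] with y hy hyd z hz
    refine Complex.norm_deriv_le_of_forall_mem_sphere_norm_le hr0 ?_ fun w hw => ?_
    · exact (hyd.mono (hsub z hz)).diffContOnCl_ball subset_rfl
    · exact hy w (hsub z hz (Metric.sphere_subset_closedBall hw))
  · filter_upwards [hda] with y hy z hz using hy z (hball hz)

/-! ### Bielecki weights -/

/-- `g` is bounded by an integrable function, up to a bounded term on the right half-line. -/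
structure LeftIntegrable {F : Type*} [NormedAddCommGroup F] (g : ℝ → F) : Prop where
  aestronglyMeasurable : AEStronglyMeasurable g
  exists_bound : ∃ (N : ℝ) (h : ℝ → ℝ), Integrable h ∧
    ∀ y, ‖g y‖ ≤ (Ici 0).indicator (fun _ => N) y + h y

/-- A Bielecki weight for `g`: integrating `‖g‖ φ` from `-∞` gains the factor `δ`. -/
structure IsWeight {F : Type*} [NormedAddCommGroup F] (g : ℝ → F) (δ : ℝ) (φ : ℝ → ℝ) :
    Prop where
  continuous : Continuous φ
  monotone : Monotone φ
  one_le : ∀ x, 1 ≤ φ x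
  integral_le : ∀ x, ∫ y in Iic x, ‖g y‖ * φ y ≤ δ * φ x

section Weight

variable {F : Type*} [NormedAddCommGroup F] {g : ℝ → F}

theorem LeftIntegrable.integrableOn_Iic (hg : LeftIntegrable g) (x : ℝ) :
    IntegrableOn g (Iic x) := by
  obtain ⟨N, h, hh, hle⟩ := hg.exists_bound
  have h1 : IntegrableOn ((Ici (0 : ℝ)).indicator fun _ => N) (Iic x) := by
    rw [integrableOn_indicator_iff measurableSet_Ici, Ici_inter_Iic]
    exact integrableOn_const (by simp)
  exact (h1.add hh.integrableOn).mono' hg.aestronglyMeasurable.restrict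
    (Eventually.of_forall fun y => hle y)

theorem IsWeight.integrableOn_mul {δ : ℝ} {φ : ℝ → ℝ} (hφ : IsWeight g δ φ)
    (hg : LeftIntegrable g) (x : ℝ) : IntegrableOn (fun y => ‖g y‖ * φ y) (Iic x) := by
  refine ((hg.integrableOn_Iic x).norm.mul_const (φ x)).mono'
    (hg.aestronglyMeasurable.norm.mul hφ.continuous.aestronglyMeasurable).restrict ?_
  filter_upwards [ae_restrict_mem measurableSet_Iic] with y hy
  have h1 := hφ.one_le y
  rw [norm_mul, norm_norm, Real.norm_of_nonneg (by linarith)]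
  exact mul_le_mul_of_nonneg_left (hφ.monotone hy) (norm_nonneg _)

/-- Replace h by a compactly supported continuous f at L¹ cost δ/2, and let φ be 1 up to -R and grow
like exp(ky) afterwards. The bounded part lives on y ≥ -R, and integrating the exponential there
gains 1/k; the L¹ remainder costs at most δ/2 · φ(x) because φ is monotone. -/
theorem LeftIntegrable.exists_isWeight (hg : LeftIntegrable g) {δ : ℝ} (hδ : 0 < δ) :
    ∃ φ, IsWeight g δ φ := by
  obtain ⟨N, h, hh, hle⟩ := hg.exists_bound
  obtain ⟨f, hfs, hfδ, hfc, hfi⟩ := hh.exists_hasCompactSupport_integral_sub_le (half_pos hδ)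
  obtain ⟨M, hM⟩ := hfs.exists_bound_of_continuous hfc
  -- R ≥ 0 ensures that the constant N, present only on y ≥ 0, is also absent left of -R.
  obtain ⟨R, hR0, hR⟩ : ∃ R : ℝ, 0 ≤ R ∧ ∀ y, y < -R → f y = 0 := by
    obtain ⟨R, hR⟩ := hfs.isCompact.isBounded.subset_closedBall 0
    refine ⟨max R 0, le_max_right _ _, fun y hy => ?_⟩
    by_contra hne
    have := hR (subset_tsupport f hne)
    rw [mem_closedBall_zero_iff, Real.norm_eq_abs] at this
    have h2 := neg_abs_le y
    have h3 := le_max_left R 0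
    linarith
  have hM0 : 0 ≤ M := (norm_nonneg _).trans (hM 0)
  -- The summand 1 only makes L, hence the rate k, positive; k is chosen so that L/k = δ/2.
  set L := |N| + M + 1 with hL
  have hL0 : 0 < L := by positivity
  set k := 2 * L / δ with hk
  have hk0 : 0 < k := by positivity
  have hLk : L / k = δ / 2 := by rw [hk]; field_simp
  set φ : ℝ → ℝ := fun y => Real.exp (k * max (y + R) 0) with hφ
  have hφc : Continuous φ := by fun_prop
  have hφm : Monotone φ := by
    intro y y' hyy
    simp only [hφ]
    gcongr
  have hφ1 : ∀ y, 1 ≤ φ y := fun y => Real.one_le_exp (by positivity)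
  have key : ∀ y, ‖g y‖ * φ y ≤ L * Real.exp (k * R) * Real.exp (k * y) + ‖h y - f y‖ * φ y := by
    intro y
    have h0 : h y ≤ f y + ‖h y - f y‖ := by
      have := le_abs_self (h y - f y)
      rw [Real.norm_eq_abs]; linarith
    have h1 := hle y
    have hφ0 : 0 < φ y := Real.exp_pos _
    by_cases hy : y < -R
    · have h2 : y ∉ Ici (0 : ℝ) := by simp only [mem_Ici, not_le]; linarith
      rw [indicator_of_notMem h2] at h1
      rw [hR y hy] at h0
      have h3 : ‖g y‖ ≤ ‖h y - f y‖ := by rw [hR y hy]; linarith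
      have := mul_le_mul_of_nonneg_right h3 hφ0.le
      have h4 : 0 < L * Real.exp (k * R) * Real.exp (k * y) := by positivity
      linarith
    · push Not at hy
      have hφy : Real.exp (k * R) * Real.exp (k * y) = φ y := by
        simp only [hφ]
        rw [max_eq_left (by linarith), ← Real.exp_add]
        ring_nf
      have h2 : (Ici (0 : ℝ)).indicator (fun _ => N) y ≤ |N| := by
        by_cases hy0 : y ∈ Ici (0 : ℝ)
        · rw [indicator_of_mem hy0]; exact le_abs_self N
        · rw [indicator_of_notMem hy0]; exact abs_nonneg N
      have h5 : f y ≤ M := (le_abs_self _).trans (hM y)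
      rw [mul_assoc, hφy, ← add_mul]
      gcongr
      linarith
  refine ⟨φ, hφc, hφm, hφ1, fun x => ?_⟩
  have hi1 : IntegrableOn (fun y => L * Real.exp (k * R) * Real.exp (k * y)) (Iic x) :=
    (integrableOn_exp_mul_Iic hk0 x).const_mul _
  have hi2 : IntegrableOn (fun y => ‖h y - f y‖ * φ x) (Iic x) :=
    ((hh.sub hfi).norm.mul_const _).integrableOn
  have hle2 : ∀ y ∈ Iic x, ‖g y‖ * φ y ≤
      L * Real.exp (k * R) * Real.exp (k * y) + ‖h y - f y‖ * φ x := by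
    intro y hy
    refine (key y).trans ?_
    gcongr
    exact hφm hy
  have hnn : ∀ y, 0 ≤ ‖g y‖ * φ y := fun y =>
    mul_nonneg (norm_nonneg _) (zero_le_one.trans (hφ1 y))
  calc ∫ y in Iic x, ‖g y‖ * φ y
      ≤ ∫ y in Iic x, (L * Real.exp (k * R) * Real.exp (k * y) + ‖h y - f y‖ * φ x) := by
        refine integral_mono_of_nonneg (Eventually.of_forall hnn) (hi1.add hi2) ?_
        filter_upwards [ae_restrict_mem measurableSet_Iic] with y hy using hle2 y hy
    _ = L * Real.exp (k * R) * (Real.exp (k * x) / k) + (∫ y in Iic x, ‖h y - f y‖) * φ x := by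
        rw [integral_add hi1 hi2, integral_const_mul, integral_exp_mul_Iic hk0,
          integral_mul_const]
    _ ≤ δ / 2 * φ x + δ / 2 * φ x := by
        have h6 : Real.exp (k * R) * Real.exp (k * x) ≤ φ x := by
          rw [← Real.exp_add, ← mul_add, add_comm R x]
          exact Real.exp_le_exp.2 (mul_le_mul_of_nonneg_left (le_max_left _ _) hk0.le)
        have h7 : ∫ y in Iic x, ‖h y - f y‖ ≤ δ / 2 :=
          (setIntegral_le_integral (hh.sub hfi).norm
            (Eventually.of_forall fun y => norm_nonneg _)).trans hfδ
        have h8 : L * Real.exp (k * R) * (Real.exp (k * x) / k) =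
            L / k * (Real.exp (k * R) * Real.exp (k * x)) := by ring
        rw [h8, hLk]
        have := hφ1 x
        gcongr
    _ = δ * φ x := by ring

end Weight

theorem tendsto_setIntegral_Iic_atBot {f : ℝ → ℝ} {c : ℝ} (hf : IntegrableOn f (Iic c)) :
    Tendsto (fun x => ∫ y in Iic x, f y) atBot (𝓝 0) := by
  have h := tendsto_setIntegral_of_antitone (μ := volume) (f := f)
    (s := fun x : ℝ => Iic (-x)) (fun _ => measurableSet_Iic)
    (fun x y hxy => Iic_subset_Iic.2 (neg_le_neg hxy)) ⟨-c, by rwa [neg_neg]⟩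
  have he : ⋂ x : ℝ, Iic (-x) = (∅ : Set ℝ) := by
    refine eq_empty_of_forall_notMem fun y hy => ?_
    have := mem_iInter.1 hy (1 - y)
    rw [mem_Iic] at this
    linarith
  rw [he, setIntegral_empty] at h
  simpa [Function.comp_def] using h.comp tendsto_neg_atBot_atTop

/-! ### Abstract Volterra equations on the half-line -/

section Volterra

variable {E : Type*} [NormedAddCommGroup E] [NormedSpace ℂ E]

/-- A continuous convolution kernel with bound `C` on the right half-line. -/
structure IsCausalKernel (a : ℝ → E →L[ℂ] E) (C : ℝ) : Prop where
  continuous : Continuous a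
  norm_le : ∀ s, 0 ≤ s → ‖a s‖ ≤ C

/-- The operator `v ↦ b + ∫_{-∞}^x a(x - y) P(y) v(y) dy`. -/
def volterraOp (a P : ℝ → E →L[ℂ] E) (b : E) (v : ℝ → E) (x : ℝ) : E :=
  b + ∫ y in Iic x, a (x - y) (P y (v y))

/-- The Picard iterates of `volterraOp`, starting from the constant `b`. -/
def picard (a P : ℝ → E →L[ℂ] E) (b : E) : ℕ → ℝ → E
  | 0 => fun _ => b
  | n + 1 => volterraOp a P b (picard a P b n)

/-- `v` is a continuous solution of `v(x) = b + ∫_{-∞}^x a(x - y) P(y) v(y) dy`, with absolutely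
convergent integral, that tends to `b` at `-∞`. -/
structure IsVolterraSolution (a P : ℝ → E →L[ℂ] E) (b : E) (v : ℝ → E) : Prop where
  continuous : Continuous v
  tendsto : Tendsto v atBot (𝓝 b)
  integrable : ∀ x, IntegrableOn (fun y => a (x - y) (P y (v y))) (Iic x)
  equation : ∀ x, v x = b + ∫ y in Iic x, a (x - y) (P y (v y))

variable {a P : ℝ → E →L[ℂ] E} {C δ : ℝ} {φ : ℝ → ℝ} {b : E} {v : ℝ → E}

theorem IsCausalKernel.nonneg (ha : IsCausalKernel a C) : 0 ≤ C :=
  (norm_nonneg _).trans (ha.norm_le 0 le_rfl)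

theorem aestronglyMeasurable_volterra (ha : Continuous a) (hP : AEStronglyMeasurable P)
    (hv : AEStronglyMeasurable v) (x : ℝ) :
    AEStronglyMeasurable fun y => a (x - y) (P y (v y)) := by
  have h1 : AEStronglyMeasurable fun y => a (x - y) :=
    (ha.comp (continuous_const.sub continuous_id)).aestronglyMeasurable
  have h2 : AEStronglyMeasurable fun y => P y (v y) :=
    (ContinuousLinearMap.id ℂ (E →L[ℂ] E)).aestronglyMeasurable_comp₂ hP hv
  exact (ContinuousLinearMap.id ℂ (E →L[ℂ] E)).aestronglyMeasurable_comp₂ h1 h2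

theorem IsCausalKernel.norm_apply_le (ha : IsCausalKernel a C) {B : ℝ} {x y : ℝ} (hy : y ≤ x)
    (hv : ‖v y‖ ≤ B * φ y) : ‖a (x - y) (P y (v y))‖ ≤ C * B * (‖P y‖ * φ y) := by
  have hC := ha.nonneg
  calc ‖a (x - y) (P y (v y))‖ ≤ ‖a (x - y)‖ * (‖P y‖ * ‖v y‖) :=
        (ContinuousLinearMap.le_opNorm _ _).trans
          (mul_le_mul_of_nonneg_left (ContinuousLinearMap.le_opNorm _ _) (norm_nonneg _))
    _ ≤ C * (‖P y‖ * (B * φ y)) := by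
        gcongr
        exact ha.norm_le _ (sub_nonneg.2 hy)
    _ = C * B * (‖P y‖ * φ y) := by ring

theorem integrableOn_volterra (ha : IsCausalKernel a C) (hP : LeftIntegrable P)
    (hφ : IsWeight P δ φ) (hv : AEStronglyMeasurable v) {B x : ℝ}
    (hB : ∀ y ≤ x, ‖v y‖ ≤ B * φ y) :
    IntegrableOn (fun y => a (x - y) (P y (v y))) (Iic x) := by
  refine ((hφ.integrableOn_mul hP x).const_mul (C * B)).mono'
    (aestronglyMeasurable_volterra ha.continuous hP.aestronglyMeasurable hv x).restrict ?_
  filter_upwards [ae_restrict_mem measurableSet_Iic] with y hy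
    using ha.norm_apply_le hy (hB y hy)

theorem norm_integral_volterra_le_setIntegral (ha : IsCausalKernel a C) (hP : LeftIntegrable P)
    (hφ : IsWeight P δ φ) {B x : ℝ} (hB : ∀ y ≤ x, ‖v y‖ ≤ B * φ y) :
    ‖∫ y in Iic x, a (x - y) (P y (v y))‖ ≤ C * B * ∫ y in Iic x, ‖P y‖ * φ y := by
  rw [← integral_const_mul]
  refine norm_integral_le_of_norm_le ((hφ.integrableOn_mul hP x).const_mul (C * B)) ?_
  filter_upwards [ae_restrict_mem measurableSet_Iic] with y hy
    using ha.norm_apply_le hy (hB y hy)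

/-- This is the contraction by 1/2 in the weighted norm. The bound on v is required only to the left
of x, which is what uniqueness can provide. -/
theorem norm_integral_volterra_le (ha : IsCausalKernel a C) (hP : LeftIntegrable P)
    (hφ : IsWeight P δ φ) (hC : C * δ ≤ 1 / 2) {B x : ℝ} (hB0 : 0 ≤ B)
    (hB : ∀ y ≤ x, ‖v y‖ ≤ B * φ y) :
    ‖∫ y in Iic x, a (x - y) (P y (v y))‖ ≤ B / 2 * φ x := by
  have h0 := ha.nonneg
  have h1 := hφ.one_le x
  calc _ ≤ C * B * ∫ y in Iic x, ‖P y‖ * φ y :=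
        norm_integral_volterra_le_setIntegral ha hP hφ hB
    _ ≤ C * B * (δ * φ x) := by gcongr; exact hφ.integral_le x
    _ = C * δ * (B * φ x) := by ring
    _ ≤ 1 / 2 * (B * φ x) := by gcongr
    _ = B / 2 * φ x := by ring

/-- Dominated convergence after extending the integrand by zero beyond x: for fixed y it is
continuous at x₀ unless y = x₀, a null set. -/
theorem continuous_volterraOp (ha : IsCausalKernel a C) (hP : LeftIntegrable P)
    (hφ : IsWeight P δ φ) (hv : AEStronglyMeasurable v) {B : ℝ} (hB0 : 0 ≤ B)
    (hB : ∀ y, ‖v y‖ ≤ B * φ y) : Continuous (volterraOp a P b v) := by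
  refine continuous_const.add (continuous_iff_continuousAt.2 fun x₀ => ?_)
  simp_rw [← integral_indicator measurableSet_Iic]
  refine continuousAt_of_dominated
    (bound := (Iic (x₀ + 1)).indicator fun y => C * B * (‖P y‖ * φ y))
    (Eventually.of_forall fun x =>
      (aestronglyMeasurable_volterra ha.continuous hP.aestronglyMeasurable hv x).indicator
        measurableSet_Iic) ?_ ?_ ?_
  · filter_upwards [Iio_mem_nhds (lt_add_one x₀)] with x hx
    refine Eventually.of_forall fun y => ?_
    have h0 : 0 ≤ C * B * (‖P y‖ * φ y) := by
      have := ha.nonneg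
      have := hφ.one_le y
      positivity
    by_cases hy : y ∈ Iic x
    · rw [indicator_of_mem hy, indicator_of_mem (show y ∈ Iic (x₀ + 1) from
        le_trans (mem_Iic.1 hy) (le_of_lt hx))]
      exact ha.norm_apply_le hy (hB y)
    · rw [indicator_of_notMem hy, norm_zero]
      exact indicator_nonneg (fun y _ => by
        have := ha.nonneg
        have := hφ.one_le y
        positivity) _
  · exact (integrable_indicator_iff measurableSet_Iic).2
      ((hφ.integrableOn_mul hP (x₀ + 1)).const_mul (C * B))
  · have hne : ∀ᵐ y : ℝ, y ≠ x₀ := by simp [ae_iff]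
    filter_upwards [hne] with y hy
    rcases lt_or_gt_of_ne hy with h | h
    · have hc : ContinuousAt (fun x => a (x - y) (P y (v y))) x₀ := by
        have := ha.continuous
        fun_prop
      refine hc.congr ?_
      filter_upwards [Ioi_mem_nhds h] with x hx
      rw [indicator_of_mem (mem_Iic.2 (le_of_lt (mem_Ioi.1 hx)))]
    · refine continuousAt_const (y := (0 : E)).congr ?_
      filter_upwards [Iio_mem_nhds h] with x hx
      rw [indicator_of_notMem (mem_Iic.not.2 (not_le.2 (mem_Iio.1 hx)))]

/-- The weighted ball of radius 2‖b‖ is invariant, since ‖b‖ + (2‖b‖)/2 = 2‖b‖. -/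
theorem picard_continuous_and_norm_le (ha : IsCausalKernel a C) (hP : LeftIntegrable P)
    (hφ : IsWeight P δ φ) (hC : C * δ ≤ 1 / 2) (b : E) (n : ℕ) :
    Continuous (picard a P b n) ∧ ∀ x, ‖picard a P b n x‖ ≤ 2 * ‖b‖ * φ x := by
  have hb : ∀ x, ‖b‖ ≤ ‖b‖ * φ x := fun x =>
    le_mul_of_one_le_right (norm_nonneg b) (hφ.one_le x)
  induction n with
  | zero =>
    refine ⟨continuous_const, fun x => ?_⟩
    have := hb x
    have := norm_nonneg b
    simp only [picard]
    linarith
  | succ n ih =>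
    refine ⟨continuous_volterraOp ha hP hφ ih.1.aestronglyMeasurable (by positivity) ih.2,
      fun x => ?_⟩
    have h := norm_integral_volterra_le ha hP hφ hC (x := x) (by positivity) fun y _ => ih.2 y
    refine (norm_add_le _ _).trans ?_
    have := hb x
    linarith

theorem picard_dist_le (ha : IsCausalKernel a C) (hP : LeftIntegrable P)
    (hφ : IsWeight P δ φ) (hC : C * δ ≤ 1 / 2) (b : E) (n : ℕ) (x : ℝ) :
    dist (picard a P b n x) (picard a P b (n + 1) x) ≤ ‖b‖ * φ x * (1 / 2) ^ n := by
  induction n generalizing x with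
  | zero =>
    have hb : ∀ y, ‖b‖ ≤ ‖b‖ * φ y := fun y =>
      le_mul_of_one_le_right (norm_nonneg b) (hφ.one_le y)
    have h := norm_integral_volterra_le (v := fun _ => b) ha hP hφ hC (x := x)
      (norm_nonneg b) fun y _ => hb y
    rw [dist_comm, dist_eq_norm]
    simp only [picard, volterraOp, add_sub_cancel_left, pow_zero, mul_one]
    refine h.trans ?_
    have := (norm_nonneg b).trans (hb x)
    linarith
  | succ n ih =>
    have hp := picard_continuous_and_norm_le ha hP hφ hC b
    have hi : ∀ m, IntegrableOn (fun y => a (x - y) (P y (picard a P b m y))) (Iic x) := fun m =>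
      integrableOn_volterra ha hP hφ (hp m).1.aestronglyMeasurable fun y _ => (hp m).2 y
    have h := norm_integral_volterra_le (x := x) (B := ‖b‖ * (1 / 2) ^ n)
      (v := fun y => picard a P b (n + 1) y - picard a P b n y) ha hP hφ hC
      (by positivity) fun y _ => by
        have := ih y
        rw [dist_comm, dist_eq_norm] at this
        linarith
    simp only [map_sub] at h
    rw [integral_sub (hi _) (hi _)] at h
    rw [dist_comm, dist_eq_norm, picard, picard, volterraOp, volterraOp, add_sub_add_left_eq_sub]
    refine h.trans (le_of_eq ?_)
    ring

theorem exists_isVolterraSolution [CompleteSpace E] (ha : IsCausalKernel a C)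
    (hP : LeftIntegrable P) (hφ : IsWeight P δ φ) (hC : C * δ ≤ 1 / 2) (b : E) :
    ∃ v, IsVolterraSolution a P b v ∧
      ∀ n x, dist (picard a P b n x) (v x) ≤ 2 * ‖b‖ * φ x * (1 / 2) ^ n := by
  have hd := picard_dist_le ha hP hφ hC b
  have hp := picard_continuous_and_norm_le ha hP hφ hC b
  have hlim : ∀ x, ∃ l, Tendsto (fun n => picard a P b n x) atTop (𝓝 l) := fun x =>
    cauchySeq_tendsto_of_complete
      (cauchySeq_of_le_geometric (1 / 2) (‖b‖ * φ x) (by norm_num) fun n => hd n x)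
  choose v hv using hlim
  have hvm : AEStronglyMeasurable v := aestronglyMeasurable_of_tendsto_ae atTop
    (fun n => (hp n).1.aestronglyMeasurable) (Eventually.of_forall hv)
  have hvB : ∀ x, ‖v x‖ ≤ 2 * ‖b‖ * φ x := fun x =>
    le_of_tendsto (hv x).norm (Eventually.of_forall fun n => (hp n).2 x)
  -- The invariant-ball bound dominates all iterates at once, so the limit passes through the
  -- integral.
  have heq : ∀ x, v x = volterraOp a P b v x := by
    intro x
    refine tendsto_nhds_unique ((tendsto_add_atTop_iff_nat 1).2 (hv x)) ?_
    simp only [picard, volterraOp]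
    refine Tendsto.const_add b (tendsto_integral_of_dominated_convergence
      (fun y => C * (2 * ‖b‖) * (‖P y‖ * φ y)) (fun n =>
      (aestronglyMeasurable_volterra ha.continuous hP.aestronglyMeasurable
        (hp n).1.aestronglyMeasurable x).restrict)
      ((hφ.integrableOn_mul hP x).const_mul _) (fun n => ?_) (Eventually.of_forall fun y => ?_))
    · filter_upwards [ae_restrict_mem measurableSet_Iic] with y hy
        using ha.norm_apply_le hy ((hp n).2 y)
    · exact ((a (x - y)).continuous.tendsto _).comp (((P y).continuous.tendsto _).comp (hv y))
  refine ⟨v, ⟨?_, ?_, fun x => integrableOn_volterra ha hP hφ hvm fun y _ => hvB y, heq⟩,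
    fun n x => ?_⟩
  · rw [show v = volterraOp a P b v from funext heq]
    exact continuous_volterraOp ha hP hφ hvm (by positivity) hvB
  · rw [tendsto_iff_norm_sub_tendsto_zero]
    have h0 : Tendsto (fun x => C * (2 * ‖b‖) * ∫ y in Iic x, ‖P y‖ * φ y) atBot (𝓝 0) := by
      have h1 : Tendsto (fun x => ∫ y in Iic x, ‖P y‖ * φ y) atBot (𝓝 0) :=
        tendsto_setIntegral_Iic_atBot (hφ.integrableOn_mul hP 0)
      simpa using h1.const_mul (C * (2 * ‖b‖))
    refine squeeze_zero (fun x => norm_nonneg _) (fun x => ?_) h0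
    rw [heq x, volterraOp, add_sub_cancel_left]
    exact norm_integral_volterra_le_setIntegral ha hP hφ fun y _ => hvB y
  · refine (dist_le_of_le_geometric_of_tendsto (1 / 2) (‖b‖ * φ x) (by norm_num)
      (fun n => hd n x) (hv x) n).trans (le_of_eq ?_)
    ring

/-- The difference solves the homogeneous equation and is bounded on (-∞, X], by its limit at -∞ and
compactness. Applying the contraction n times bounds it by B 2⁻ⁿ φ there. -/
theorem IsVolterraSolution.unique {v₁ v₂ : ℝ → E} (ha : IsCausalKernel a C)
    (hP : LeftIntegrable P) (hφ : IsWeight P δ φ) (hC : C * δ ≤ 1 / 2)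
    (h₁ : IsVolterraSolution a P b v₁) (h₂ : IsVolterraSolution a P b v₂) : v₁ = v₂ := by
  funext X
  set d : ℝ → E := fun y => v₁ y - v₂ y with hd
  have hdc : Continuous d := h₁.continuous.sub h₂.continuous
  have hd0 : Tendsto d atBot (𝓝 0) := by simpa using h₁.tendsto.sub h₂.tendsto
  obtain ⟨B, hB0, hB⟩ : ∃ B, 0 ≤ B ∧ ∀ y ≤ X, ‖d y‖ ≤ B := by
    have hev : ∀ᶠ y in atBot, ‖d y‖ ≤ 1 :=
      (hd0.norm.eventually_le_const (by simp : ‖(0 : E)‖ < 1))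
    obtain ⟨R, hR⟩ := eventually_atBot.1 hev
    obtain ⟨M, hM⟩ := (isCompact_Icc (a := R) (b := X)).exists_bound_of_continuousOn
      hdc.continuousOn
    refine ⟨max 1 M, by positivity, fun y hy => ?_⟩
    rcases le_total y R with h | h
    · exact (hR y h).trans (le_max_left _ _)
    · exact (hM y ⟨h, hy⟩).trans (le_max_right _ _)
  have hde : ∀ x, d x = ∫ y in Iic x, a (x - y) (P y (d y)) := by
    intro x
    simp only [hd, map_sub]
    rw [integral_sub (h₁.integrable x) (h₂.integrable x), h₁.equation x, h₂.equation x,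
      add_sub_add_left_eq_sub]
  have hn : ∀ n : ℕ, ∀ x ≤ X, ‖d x‖ ≤ B * (1 / 2) ^ n * φ x := by
    intro n
    induction n with
    | zero =>
      intro x hx
      rw [pow_zero, mul_one]
      exact (hB x hx).trans (le_mul_of_one_le_right hB0 (hφ.one_le x))
    | succ n ih =>
      intro x hx
      rw [hde x]
      refine (norm_integral_volterra_le ha hP hφ hC (by positivity)
        fun y hy => ih y (hy.trans hx)).trans (le_of_eq ?_)
      ring
  have hlim : Tendsto (fun n : ℕ => B * (1 / 2 : ℝ) ^ n * φ X) atTop (𝓝 0) := by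
    have := ((tendsto_pow_atTop_nhds_zero_of_lt_one (by norm_num : (0 : ℝ) ≤ 1 / 2)
      (by norm_num)).const_mul B).mul_const (φ X)
    simpa using this
  have hz : ‖d X‖ ≤ 0 := ge_of_tendsto' hlim fun n => hn n X le_rfl
  exact sub_eq_zero.1 (norm_le_zero_iff.1 hz)

theorem existsUnique_isVolterraSolution [CompleteSpace E] (ha : IsCausalKernel a C)
    (hP : LeftIntegrable P) (b : E) : ∃! v, IsVolterraSolution a P b v := by
  have hC0 := ha.nonneg
  -- C + 1 rather than C, because C may be 0.
  obtain ⟨φ, hφ⟩ := hP.exists_isWeight (δ := 1 / (2 * (C + 1))) (by positivity)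
  have hC : C * (1 / (2 * (C + 1))) ≤ 1 / 2 := by
    rw [mul_one_div, div_le_div_iff₀ (by positivity) (by norm_num)]
    linarith
  obtain ⟨v, hv, -⟩ := exists_isVolterraSolution ha hP hφ hC b
  exact ⟨v, hv, fun w hw => hw.unique ha hP hφ hC hv⟩

/-- The weight depends on P alone and C, M are uniform on U, so a single integrable function
dominates the integrand for all parameters. -/
theorem differentiableOn_picard {A : ℂ → ℝ → E →L[ℂ] E} {β : ℂ → E} {U : Set ℂ} {M : ℝ}
    (hU : IsOpen U) (hA : ∀ z ∈ U, IsCausalKernel (A z) C)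
    (hAd : ∀ s, DifferentiableOn ℂ (fun z => A z s) U) (hβ : DifferentiableOn ℂ β U)
    (hM : ∀ z ∈ U, ‖β z‖ ≤ M) (hP : LeftIntegrable P) (hφ : IsWeight P δ φ)
    (hC : C * δ ≤ 1 / 2) (n : ℕ) (x : ℝ) :
    DifferentiableOn ℂ (fun z => picard (A z) P (β z) n x) U := by
  induction n generalizing x with
  | zero => exact hβ
  | succ n ih =>
    have hp := fun z hz => picard_continuous_and_norm_le (hA z hz) hP hφ hC (β z) n
    refine hβ.add (differentiableOn_integral_of_dominated
      (F := fun z y => A z (x - y) (P y (picard (A z) P (β z) n y))) hU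
      ((hφ.integrableOn_mul hP x).const_mul (C * (2 * M))) (fun z hz =>
        (aestronglyMeasurable_volterra (hA z hz).continuous hP.aestronglyMeasurable
          (hp z hz).1.aestronglyMeasurable x).restrict) ?_ (Eventually.of_forall fun y => ?_))
    · filter_upwards [ae_restrict_mem measurableSet_Iic] with y hy z hz
      refine (hA z hz).norm_apply_le hy (((hp z hz).2 y).trans ?_)
      have := hM z hz
      have := hφ.one_le y
      gcongr
    · exact (hAd (x - y)).clm_apply ((P y).differentiable.comp_differentiableOn (ih y))

/-- Solutions of Volterra equations whose kernel depends holomorphically on a parameter are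
holomorphic in that parameter. -/
theorem analyticOnNhd_of_isVolterraSolution [CompleteSpace E] {A : ℂ → ℝ → E →L[ℂ] E}
    {β : ℂ → E} {U : Set ℂ} (hU : IsOpen U)
    (hA : ∀ z ∈ U, ∃ C, ∃ V ∈ 𝓝 z, ∀ w ∈ V, w ∈ U → IsCausalKernel (A w) C)
    (hAd : ∀ s, DifferentiableOn ℂ (fun z => A z s) U) (hβ : DifferentiableOn ℂ β U)
    (hP : LeftIntegrable P) {v : ℂ → ℝ → E}
    (hv : ∀ z ∈ U, IsVolterraSolution (A z) P (β z) (v z)) (x : ℝ) :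
    AnalyticOnNhd ℂ (fun z => v z x) U := by
  refine DifferentiableOn.analyticOnNhd (fun z₀ hz₀ => ?_) hU
  obtain ⟨C, V, hV, hVC⟩ := hA z₀ hz₀
  have hβn : {z | ‖β z‖ < ‖β z₀‖ + 1} ∈ 𝓝 z₀ :=
    ((hβ z₀ hz₀).continuousWithinAt.continuousAt (hU.mem_nhds hz₀)).norm.eventually_lt_const
      (lt_add_one _)
  -- On W both the kernel bound and ‖β‖ are uniform, which makes the Picard convergence uniform.
  obtain ⟨W, hWsub, hWo, hzW⟩ :=
    mem_nhds_iff.1 (inter_mem (inter_mem hV hβn) (hU.mem_nhds hz₀))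
  have hWU : W ⊆ U := fun z hz => (hWsub hz).2
  have hAW : ∀ z ∈ W, IsCausalKernel (A z) C := fun z hz => hVC z (hWsub hz).1.1 (hWU hz)
  have hMW : ∀ z ∈ W, ‖β z‖ ≤ ‖β z₀‖ + 1 := fun z hz => le_of_lt (hWsub hz).1.2
  have hC0 := (hAW z₀ hzW).nonneg
  obtain ⟨φ, hφ⟩ := hP.exists_isWeight (δ := 1 / (2 * (C + 1))) (by positivity)
  have hC : C * (1 / (2 * (C + 1))) ≤ 1 / 2 := by
    rw [mul_one_div, div_le_div_iff₀ (by positivity) (by norm_num)]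
    linarith
  have hpd : ∀ n, DifferentiableOn ℂ (fun z => picard (A z) P (β z) n x) W := fun n =>
    differentiableOn_picard hWo hAW (fun s => (hAd s).mono hWU) (hβ.mono hWU) hMW hP hφ hC n x
  have hφ1 := hφ.one_le x
  have hunif : TendstoUniformlyOn (fun n z => picard (A z) P (β z) n x) (fun z => v z x)
      atTop W := by
    rw [Metric.tendstoUniformlyOn_iff]
    intro ε hε
    have hlim : Tendsto (fun n : ℕ => 2 * (‖β z₀‖ + 1) * φ x * (1 / 2 : ℝ) ^ n) atTop (𝓝 0) := by
      have := (tendsto_pow_atTop_nhds_zero_of_lt_one (by norm_num : (0 : ℝ) ≤ 1 / 2)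
        (by norm_num)).const_mul (2 * (‖β z₀‖ + 1) * φ x)
      simpa using this
    filter_upwards [hlim.eventually_lt_const hε] with n hn z hz
    obtain ⟨w, hw, hwd⟩ := exists_isVolterraSolution (hAW z hz) hP hφ hC (β z)
    -- Uniqueness identifies the given solution with the Picard limit.
    rw [(hv z (hWU hz)).unique (hAW z hz) hP hφ hC hw, dist_comm]
    refine (hwd n x).trans_lt (lt_of_le_of_lt ?_ hn)
    have := hMW z hz
    gcongr
  exact ((hunif.tendstoLocallyUniformlyOn.differentiableOn (Eventually.of_forall hpd)
    hWo).differentiableAt (hWo.mem_nhds hzW)).differentiableWithinAt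

end Volterra

/-! ### The column equations as Volterra equations -/

/-- A `2 × 2` matrix as a continuous linear map on column vectors. -/
def matCLM (M : Matrix (Fin 2) (Fin 2) ℂ) : (Fin 2 → ℂ) →L[ℂ] (Fin 2 → ℂ) :=
  ∑ i, ∑ j, M i j • (ContinuousLinearMap.single ℂ (fun _ : Fin 2 => ℂ) i).comp
    (ContinuousLinearMap.proj j)

theorem matCLM_apply (M : Matrix (Fin 2) (Fin 2) ℂ) (c : Fin 2 → ℂ) :
    matCLM M c = M.mulVec c := by
  ext i
  fin_cases i <;> simp [matCLM, Matrix.mulVec, dotProduct, Fin.sum_univ_two]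

theorem norm_matCLM_le (M : Matrix (Fin 2) (Fin 2) ℂ) :
    ‖matCLM M‖ ≤ ∑ i, ∑ j, ‖M i j‖ := by
  refine norm_sum_le_of_le _ fun i _ => norm_sum_le_of_le _ fun j _ => ?_
  rw [norm_smul]
  refine mul_le_of_le_one_right (norm_nonneg _)
    (ContinuousLinearMap.opNorm_le_bound _ zero_le_one fun c => ?_)
  rw [one_mul]
  refine (pi_norm_le_iff_of_nonneg (norm_nonneg c)).2 fun k => ?_
  by_cases hk : k = i
  · subst hk
    simpa using norm_le_pi_norm c j
  · simp [hk]

theorem continuous_matCLM {X : Type*} [TopologicalSpace X] {M : X → Matrix (Fin 2) (Fin 2) ℂ}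
    (h : ∀ i j, Continuous fun x => M x i j) : Continuous fun x => matCLM (M x) := by
  unfold matCLM
  exact continuous_finsetSum _ fun i _ => continuous_finsetSum _ fun j _ =>
    (h i j).smul continuous_const

theorem differentiableOn_matCLM {M : ℂ → Matrix (Fin 2) (Fin 2) ℂ} {U : Set ℂ}
    (h : ∀ i j, DifferentiableOn ℂ (fun z => M z i j) U) :
    DifferentiableOn ℂ (fun z => matCLM (M z)) U := by
  unfold matCLM
  exact DifferentiableOn.fun_sum fun i _ => DifferentiableOn.fun_sum fun j _ =>
    (h i j).smul_const _

/-- The matrix by which `exp (a σ̂₃)` acts on the `j`-th column. -/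
def columnExp (j : Fin 2) (a : ℂ) : Matrix (Fin 2) (Fin 2) ℂ :=
  expSigma3 (-a) j j • expSigma3 a

/-- The convolution kernel of the Volterra equation for the `j`-th column. -/
def kernel (w : ℂ) (q0 : ℝ) (j : Fin 2) (z : ℂ) (s : ℝ) : (Fin 2 → ℂ) →L[ℂ] (Fin 2 → ℂ) :=
  matCLM (eigY w z) ∘L matCLM (columnExp j (-(Complex.I * lam q0 z * (s : ℂ)))) ∘L
    matCLM (eigY w z)⁻¹

/-- The perturbation of the potential as a linear map. -/
def perturbation (p : ℝ → ℂ) (w : ℂ) (y : ℝ) : (Fin 2 → ℂ) →L[ℂ] (Fin 2 → ℂ) :=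
  matCLM (potential (p y - w))

theorem potential_sub (u w : ℂ) : potential u - potential w = potential (u - w) := by
  ext i j
  fin_cases i <;> fin_cases j <;> simp [potential]; ring

/-- Y⁻¹ is moved into the kernel, so that the remaining factor is independent of z. -/
theorem integrandCol_eq (p : ℝ → ℂ) (w : ℂ) (q0 : ℝ) (z : ℂ) (j : Fin 2) (x y : ℝ)
    (c : Fin 2 → ℂ) :
    integrandCol p w q0 z j x y c = kernel w q0 j z (x - y) (perturbation p w y c) := by
  simp only [integrandCol, hatExpCol, kernel, perturbation, columnExp, potential_sub,
    ContinuousLinearMap.comp_apply, matCLM_apply, Matrix.smul_mulVec, Complex.ofReal_sub,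
    ← Matrix.mulVec_mulVec]

/-- The sign of the `j`-th diagonal entry of `σ₃`. -/
def sigmaSign : Fin 2 → ℝ := ![1, -1]

/-- The diagonal is (1, e^{2iλs}) for the first column and (e^{-2iλs}, 1) for the second: one entry
is 1 and the sign condition keeps the other in the unit disc. The bound 2 is their sum. -/
theorem norm_matCLM_columnExp_le {j : Fin 2} {l : ℂ} {s : ℝ} (h : 0 ≤ sigmaSign j * l.im * s) :
    ‖matCLM (columnExp j (-(Complex.I * l * (s : ℂ))))‖ ≤ 2 := by
  refine (norm_matCLM_le _).trans ?_
  fin_cases j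
  · simp [sigmaSign] at h
    simp [columnExp, expSigma3, Fin.sum_univ_two, Complex.norm_exp, ← Real.exp_add]
    nlinarith [Real.exp_le_one_iff.2 (show -(l.im * s) + -(l.im * s) ≤ 0 by linarith)]
  · simp [sigmaSign] at h
    simp [columnExp, expSigma3, Fin.sum_univ_two, Complex.norm_exp, ← Real.exp_add]
    nlinarith [Real.exp_le_one_iff.2 (show (l.im * s) + (l.im * s) ≤ 0 by linarith)]

theorem norm_kernel_le (w : ℂ) (q0 : ℝ) {j : Fin 2} {z : ℂ} {s : ℝ}
    (h : 0 ≤ sigmaSign j * (lam q0 z).im * s) :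
    ‖kernel w q0 j z s‖ ≤ ‖matCLM (eigY w z)‖ * (2 * ‖matCLM (eigY w z)⁻¹‖) := by
  refine (ContinuousLinearMap.opNorm_comp_le _ _).trans
    (mul_le_mul_of_nonneg_left ?_ (norm_nonneg _))
  exact (ContinuousLinearMap.opNorm_comp_le _ _).trans
    (mul_le_mul_of_nonneg_right (norm_matCLM_columnExp_le h) (norm_nonneg _))

theorem continuous_columnExp_apply (j i k : Fin 2) : Continuous fun a => columnExp j a i k := by
  fin_cases j <;> fin_cases i <;> fin_cases k <;> simp [columnExp, expSigma3] <;> fun_prop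

theorem differentiable_columnExp_apply (j i k : Fin 2) :
    Differentiable ℂ fun a => columnExp j a i k := by
  fin_cases j <;> fin_cases i <;> fin_cases k <;> simp [columnExp, expSigma3] <;> fun_prop

theorem continuous_kernel (w : ℂ) (q0 : ℝ) (j : Fin 2) (z : ℂ) :
    Continuous (kernel w q0 j z) := by
  have h : Continuous fun s : ℝ => matCLM (columnExp j (-(Complex.I * lam q0 z * (s : ℂ)))) :=
    continuous_matCLM fun i k => (continuous_columnExp_apply j i k).comp
      (continuous_const.mul Complex.continuous_ofReal).neg
  unfold kernel
  exact continuous_const.clm_comp (h.clm_comp continuous_const)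

/-- No condition on the determinant is needed: where it vanishes, both sides are 0 by the
conventions for inverses. -/
theorem eigY_inv (w z : ℂ) : (eigY w z)⁻¹ = (1 + w * starRingEnd ℂ w / z ^ 2)⁻¹ •
    !![1, Complex.I * w / z; Complex.I * starRingEnd ℂ w / z, 1] := by
  have hdet : (eigY w z).det = 1 + w * starRingEnd ℂ w / z ^ 2 := by
    rw [eigY, Matrix.det_fin_two_of]
    ring_nf
    rw [Complex.I_sq]
    ring
  rw [Matrix.inv_def, Ring.inverse_eq_inv', hdet, eigY, Matrix.adjugate_fin_two_of]
  simp

section Regular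

variable {w : ℂ} {q0 : ℝ} {U : Set ℂ}

theorem differentiableOn_eigY_apply (h0 : ∀ z ∈ U, z ≠ 0) (i j : Fin 2) :
    DifferentiableOn ℂ (fun z => eigY w z i j) U := by
  have h : ∀ c : ℂ, DifferentiableOn ℂ (fun z => c / z) U := fun c =>
    (differentiableOn_const c).div differentiableOn_id h0
  fin_cases i <;> fin_cases j <;> simp [eigY, h]

theorem differentiableOn_eigY_inv_apply (h0 : ∀ z ∈ U, z ≠ 0)
    (h1 : ∀ z ∈ U, 1 + w * starRingEnd ℂ w / z ^ 2 ≠ 0) (i j : Fin 2) :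
    DifferentiableOn ℂ (fun z => (eigY w z)⁻¹ i j) U := by
  have h : ∀ c : ℂ, DifferentiableOn ℂ (fun z => c / z) U := fun c =>
    (differentiableOn_const c).div differentiableOn_id h0
  have hd : DifferentiableOn ℂ (fun z => (1 + w * starRingEnd ℂ w / z ^ 2)⁻¹) U :=
    DifferentiableOn.inv ((differentiableOn_const _).add
      ((differentiableOn_const _).div (differentiableOn_id.pow 2)
        fun z hz => pow_ne_zero 2 (h0 z hz))) h1
  simp_rw [eigY_inv, Matrix.smul_apply, smul_eq_mul]
  refine hd.mul ?_
  fin_cases i <;> fin_cases j <;> simp [h]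

theorem differentiableOn_kernel (h0 : ∀ z ∈ U, z ≠ 0)
    (h1 : ∀ z ∈ U, 1 + w * starRingEnd ℂ w / z ^ 2 ≠ 0) (j : Fin 2) (s : ℝ) :
    DifferentiableOn ℂ (fun z => kernel w q0 j z s) U := by
  have hl : DifferentiableOn ℂ (fun z => -(Complex.I * lam q0 z * (s : ℂ))) U := by
    unfold lam
    exact (((differentiableOn_const _).mul ((differentiableOn_id.add
      ((differentiableOn_const _).div differentiableOn_id h0)).div_const 2)).mul_const _).neg
  have h2 : DifferentiableOn ℂ
      (fun z => matCLM (columnExp j (-(Complex.I * lam q0 z * (s : ℂ))))) U :=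
    differentiableOn_matCLM fun i k =>
      (differentiable_columnExp_apply j i k).comp_differentiableOn hl
  exact (differentiableOn_matCLM (differentiableOn_eigY_apply h0)).clm_comp
    (h2.clm_comp (differentiableOn_matCLM (differentiableOn_eigY_inv_apply h0 h1)))

/-- The bound of `norm_kernel_le` is locally uniform in the spectral parameter. -/
theorem exists_local_bound (hU : IsOpen U) (h0 : ∀ z ∈ U, z ≠ 0)
    (h1 : ∀ z ∈ U, 1 + w * starRingEnd ℂ w / z ^ 2 ≠ 0) {z : ℂ} (hz : z ∈ U) :
    ∃ C, ∃ V ∈ 𝓝 z, ∀ u ∈ V, ‖matCLM (eigY w u)‖ * (2 * ‖matCLM (eigY w u)⁻¹‖) ≤ C := by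
  have hc1 : ContinuousAt (fun u => matCLM (eigY w u)) z :=
    (differentiableOn_matCLM (differentiableOn_eigY_apply h0)).continuousOn.continuousAt
      (hU.mem_nhds hz)
  have hc2 : ContinuousAt (fun u => matCLM (eigY w u)⁻¹) z :=
    (differentiableOn_matCLM (differentiableOn_eigY_inv_apply h0 h1)).continuousOn.continuousAt
      (hU.mem_nhds hz)
  have hc := hc1.norm.mul (hc2.norm.const_mul 2)
  exact ⟨_, _, hc.eventually_le_const (lt_add_one _), fun u hu => hu⟩

end Regular

/-! ### The potential and the reflection x ↦ -x -/

theorem LeftIntegrable.perturbation {f : ℝ → ℂ} (hf : LeftIntegrable f) :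
    LeftIntegrable fun y => matCLM (potential (f y)) := by
  have hc : Continuous fun u => matCLM (potential u) := by
    refine continuous_matCLM fun i j => ?_
    have := Complex.continuous_conj
    fin_cases i <;> fin_cases j <;> simp [potential] <;> fun_prop
  refine ⟨hc.comp_aestronglyMeasurable hf.aestronglyMeasurable, ?_⟩
  obtain ⟨N, h, hh, hle⟩ := hf.exists_bound
  refine ⟨2 * N, fun y => 2 * h y, hh.const_mul 2, fun y => (norm_matCLM_le _).trans ?_⟩
  have h2 := hle y
  have h3 : (Ici (0 : ℝ)).indicator (fun _ => 2 * N) y =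
      2 * (Ici (0 : ℝ)).indicator (fun _ => N) y :=
    indicator_const_mul _ _ _ _
  rw [h3]
  simp [potential, Fin.sum_univ_two]
  linarith

/-- On the right half-line f = (f + c) - c is integrable up to a constant; c will be the difference
of the two boundary values. -/
theorem leftIntegrable_of_integrableOn {f : ℝ → ℂ} (c : ℂ) (hf : IntegrableOn f (Iic 0))
    (hc : IntegrableOn (fun y => f y + c) (Ici 0)) : LeftIntegrable f := by
  have hm : AEStronglyMeasurable f := by
    have h2 : AEStronglyMeasurable f (volume.restrict (Ici 0)) := by
      simpa [Pi.sub_def] using hc.aestronglyMeasurable.sub (aestronglyMeasurable_const (b := c))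
    have := aestronglyMeasurable_union_iff.2 ⟨hf.aestronglyMeasurable, h2⟩
    rwa [Iic_union_Ici, Measure.restrict_univ] at this
  refine ⟨hm, ‖c‖, fun y => (Iic 0).indicator (fun y => ‖f y‖) y +
    (Ici 0).indicator (fun y => ‖f y + c‖) y, ?_, fun y => ?_⟩
  · exact ((integrable_indicator_iff measurableSet_Iic).2 hf.norm).add
      ((integrable_indicator_iff measurableSet_Ici).2 hc.norm)
  · beta_reduce
    have h1 : 0 ≤ (Iic (0 : ℝ)).indicator (fun y => ‖f y‖) y :=
      indicator_nonneg (fun _ _ => norm_nonneg _) _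
    by_cases hy : y ∈ Ici (0 : ℝ)
    · rw [indicator_of_mem hy, indicator_of_mem hy]
      have := norm_sub_le (f y + c) c
      rw [add_sub_cancel_right] at this
      linarith
    · rw [indicator_of_notMem hy, indicator_of_notMem hy,
        indicator_of_mem (mem_Iic.2 (not_le.1 (mem_Ici.not.1 hy)).le)]
      simp

theorem integrableOn_comp_neg_iff {F : Type*} [NormedAddCommGroup F] {f : ℝ → F} {x : ℝ} :
    IntegrableOn (fun y => f (-y)) (Iic (-x)) ↔ IntegrableOn f (Ici x) := by
  have h := (Measure.measurePreserving_neg (volume : Measure ℝ)).integrableOn_comp_preimage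
    (Homeomorph.neg ℝ).measurableEmbedding (f := f) (s := Ici x)
  simpa [Function.comp_def] using h

theorem setIntegral_comp_neg_Iic {F : Type*} [NormedAddCommGroup F] [NormedSpace ℝ F]
    (f : ℝ → F) (x : ℝ) : ∫ y in Iic (-x), f (-y) = ∫ y in Ici x, f y := by
  rw [integral_comp_neg_Iic, neg_neg, integral_Ici_eq_integral_Ioi]

theorem isMinusColumn_iff {p : ℝ → ℂ} {w : ℂ} {q0 : ℝ} {z : ℂ} {j : Fin 2}
    {v : ℝ → Fin 2 → ℂ} : IsMinusColumn p w q0 z j v ↔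
      IsVolterraSolution (kernel w q0 j z) (perturbation p w) ((eigY w z).col j) v := by
  have hk : ∀ x, (fun y => integrandCol p w q0 z j x y (v y)) =
      fun y => kernel w q0 j z (x - y) (perturbation p w y (v y)) := fun x =>
    funext fun y => integrandCol_eq p w q0 z j x y (v y)
  exact ⟨fun ⟨h1, h2, h3, h4⟩ => ⟨h1, h2, fun x => hk x ▸ h3 x, fun x => hk x ▸ h4 x⟩,
    fun ⟨h1, h2, h3, h4⟩ => ⟨h1, h2, fun x => (hk x).symm ▸ h3 x,
      fun x => (hk x).symm ▸ h4 x⟩⟩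

/-- Reflection turns ∫_x^∞ into an integral from -∞. The minus sign is absorbed by the kernel, whose
reversed argument reverses the sign required of Im λ. -/
theorem isPlusColumn_iff {p : ℝ → ℂ} {w : ℂ} {q0 : ℝ} {z : ℂ} {j : Fin 2}
    {v : ℝ → Fin 2 → ℂ} : IsPlusColumn p w q0 z j v ↔
      IsVolterraSolution (fun s => -kernel w q0 j z (-s)) (fun y => perturbation p w (-y))
        ((eigY w z).col j) (fun x => v (-x)) := by
  have hk : ∀ x y : ℝ, -kernel w q0 j z (-(-x - y)) (perturbation p w (-y) (v (-y))) =
      -integrandCol p w q0 z j x (-y) (v (-y)) := fun x y => by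
    rw [integrandCol_eq]
    congr 3
    ring
  constructor
  · rintro ⟨h1, h2, h3, h4⟩
    refine ⟨h1.comp continuous_neg, h2.comp tendsto_neg_atBot_atTop, fun x => ?_, fun x => ?_⟩
    · rw [← neg_neg x]
      simp only [neg_apply, hk]
      exact (integrableOn_comp_neg_iff (f := fun y =>
        -integrandCol p w q0 z j (-x) y (v y))).2 (h3 (-x)).neg
    · rw [← neg_neg x]
      simp only [neg_apply, hk]
      rw [neg_neg, h4 (-x), setIntegral_comp_neg_Iic (fun y =>
        -integrandCol p w q0 z j (-x) y (v y)), integral_neg, sub_eq_add_neg]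
  · rintro ⟨h1, h2, h3, h4⟩
    refine ⟨by simpa [Function.comp_def] using h1.comp continuous_neg,
      by simpa [Function.comp_def] using h2.comp tendsto_neg_atTop_atBot,
      fun x => ?_, fun x => ?_⟩
    · have := h3 (-x)
      simp only [neg_apply, hk] at this
      simpa using ((integrableOn_comp_neg_iff (f := fun y =>
        -integrandCol p w q0 z j x y (v y))).1 this).neg
    · have := h4 (-x)
      simp only [neg_apply, hk] at this
      rwa [neg_neg, setIntegral_comp_neg_Iic (fun y =>
        -integrandCol p w q0 z j x y (v y)), integral_neg, ← sub_eq_add_neg] at this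

/-! ### Existence, uniqueness and analyticity of the columns -/

theorem isCausalKernel_kernel {w : ℂ} {q0 : ℝ} {j : Fin 2} {z : ℂ} {C : ℝ}
    (h : 0 ≤ sigmaSign j * (lam q0 z).im)
    (hC : ‖matCLM (eigY w z)‖ * (2 * ‖matCLM (eigY w z)⁻¹‖) ≤ C) :
    IsCausalKernel (kernel w q0 j z) C :=
  ⟨continuous_kernel w q0 j z, fun _ hs => (norm_kernel_le w q0 (mul_nonneg h hs)).trans hC⟩

theorem isCausalKernel_neg_kernel {w : ℂ} {q0 : ℝ} {j : Fin 2} {z : ℂ} {C : ℝ}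
    (h : sigmaSign j * (lam q0 z).im ≤ 0)
    (hC : ‖matCLM (eigY w z)‖ * (2 * ‖matCLM (eigY w z)⁻¹‖) ≤ C) :
    IsCausalKernel (fun s => -kernel w q0 j z (-s)) C :=
  ⟨((continuous_kernel w q0 j z).comp continuous_neg).neg, fun s hs => by
    rw [norm_neg]
    exact (norm_kernel_le w q0
      (mul_nonneg_of_nonpos_of_nonpos h (neg_nonpos.2 hs))).trans hC⟩

theorem existsUnique_isMinusColumn {p : ℝ → ℂ} {w : ℂ} {q0 : ℝ} {z : ℂ} {j : Fin 2}
    (hp : LeftIntegrable fun y => p y - w) (h : 0 ≤ sigmaSign j * (lam q0 z).im) :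
    ∃! v, IsMinusColumn p w q0 z j v := by
  simp_rw [isMinusColumn_iff]
  exact existsUnique_isVolterraSolution (isCausalKernel_kernel h le_rfl) hp.perturbation _

theorem existsUnique_isPlusColumn {p : ℝ → ℂ} {w : ℂ} {q0 : ℝ} {z : ℂ} {j : Fin 2}
    (hp : LeftIntegrable fun y => p (-y) - w) (h : sigmaSign j * (lam q0 z).im ≤ 0) :
    ∃! v, IsPlusColumn p w q0 z j v := by
  simp_rw [isPlusColumn_iff]
  obtain ⟨u, hu, hu'⟩ := existsUnique_isVolterraSolution
    (isCausalKernel_neg_kernel (w := w) h le_rfl) hp.perturbation ((eigY w z).col j)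
  refine ⟨fun x => u (-x), by simp only [neg_neg]; exact hu, fun v hv => ?_⟩
  funext x
  simpa using congrFun (hu' _ hv) (-x)

theorem analyticOnNhd_muMinus {q : ℝ → ℝ → ℂ} {w : ℂ} {q0 t : ℝ} {j : Fin 2} {U : Set ℂ}
    (hU : IsOpen U) (h0 : ∀ z ∈ U, z ≠ 0)
    (h1 : ∀ z ∈ U, 1 + w * starRingEnd ℂ w / z ^ 2 ≠ 0)
    (hs : ∀ z ∈ U, 0 ≤ sigmaSign j * (lam q0 z).im)
    (hp : LeftIntegrable fun y => q y t - w) (x : ℝ) :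
    AnalyticOnNhd ℂ (fun z => (muMinus q w q0 x t z).col j) U := by
  refine analyticOnNhd_of_isVolterraSolution (A := kernel w q0 j)
    (P := perturbation (fun y => q y t) w) (β := fun z => (eigY w z).col j)
    (v := fun z => Classical.epsilon (fun v => IsMinusColumn (fun y => q y t) w q0 z j v))
    hU (fun z hz => ?_) (differentiableOn_kernel h0 h1 j)
    (differentiableOn_pi.2 fun i => differentiableOn_eigY_apply h0 i j)
    hp.perturbation (fun z hz => ?_) x
  · obtain ⟨C, V, hV, hC⟩ := exists_local_bound hU h0 h1 hz
    exact ⟨C, V, hV, fun u hu huU => isCausalKernel_kernel (hs u huU) (hC u hu)⟩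
  -- Existence holds throughout U, so the chosen function is a genuine solution there.
  · exact isMinusColumn_iff.1
      (Classical.epsilon_spec (existsUnique_isMinusColumn hp (hs z hz)).exists)

theorem analyticOnNhd_muPlus {q : ℝ → ℝ → ℂ} {w : ℂ} {q0 t : ℝ} {j : Fin 2} {U : Set ℂ}
    (hU : IsOpen U) (h0 : ∀ z ∈ U, z ≠ 0)
    (h1 : ∀ z ∈ U, 1 + w * starRingEnd ℂ w / z ^ 2 ≠ 0)
    (hs : ∀ z ∈ U, sigmaSign j * (lam q0 z).im ≤ 0)
    (hp : LeftIntegrable fun y => q (-y) t - w) (x : ℝ) :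
    AnalyticOnNhd ℂ (fun z => (muPlus q w q0 x t z).col j) U := by
  have h := analyticOnNhd_of_isVolterraSolution (A := fun z s => -kernel w q0 j z (-s))
    (P := fun y => perturbation (fun y => q y t) w (-y)) (β := fun z => (eigY w z).col j)
    (v := fun z x =>
      Classical.epsilon (fun v => IsPlusColumn (fun y => q y t) w q0 z j v) (-x))
    hU (fun z hz => ?_) (fun s => (differentiableOn_kernel h0 h1 j (-s)).neg)
    (differentiableOn_pi.2 fun i => differentiableOn_eigY_apply h0 i j)
    hp.perturbation (fun z hz => ?_) (-x)
  · simp only [neg_neg] at h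
    exact h
  · obtain ⟨C, V, hV, hC⟩ := exists_local_bound hU h0 h1 hz
    exact ⟨C, V, hV, fun u hu huU => isCausalKernel_neg_kernel (hs u huU) (hC u hu)⟩
  · exact isPlusColumn_iff.1
      (Classical.epsilon_spec (existsUnique_isPlusColumn (p := fun y => q y t) hp
        (hs z hz)).exists)

/-! ### The sign of Im λ and the spectral regions -/

theorem lam_im (q0 : ℝ) (z : ℂ) :
    (lam q0 z).im = (‖z‖ ^ 2 - q0 ^ 2) * z.im / (2 * ‖z‖ ^ 2) := by
  -- At z = 0 both sides are 0, by the convention for division by zero.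
  by_cases hz : z = 0
  · simp [hz, lam]
  have hn : ‖z‖ ≠ 0 := norm_ne_zero_iff.2 hz
  have h2 : ((q0 : ℂ) ^ 2 / z).im = -(q0 ^ 2 * z.im / ‖z‖ ^ 2) := by
    rw [← Complex.ofReal_pow, Complex.div_im, Complex.ofReal_im, Complex.ofReal_re,
      Complex.normSq_eq_norm_sq]
    ring
  have h3 : (lam q0 z).im = (z.im + ((q0 : ℂ) ^ 2 / z).im) / 2 := by
    have : lam q0 z = ((1 / 2 : ℝ) : ℂ) * (z + (q0 : ℂ) ^ 2 / z) := by
      rw [lam]; push_cast; ring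
    rw [this, Complex.im_ofReal_mul, Complex.add_im]
    ring
  rw [h3, h2]
  field_simp
  ring

theorem lam_im_nonneg {q0 : ℝ} {z : ℂ} (hz : z ∈ Dplus q0) : 0 ≤ (lam q0 z).im := by
  rw [lam_im]
  exact div_nonneg (le_of_lt hz) (by positivity)

theorem lam_im_nonpos {q0 : ℝ} {z : ℂ} (hz : z ∈ Dminus q0) : (lam q0 z).im ≤ 0 := by
  rw [lam_im]
  exact div_nonpos_of_nonpos_of_nonneg (le_of_lt hz) (by positivity)

theorem lam_im_eq_zero {q0 : ℝ} {z : ℂ} (hz : z ∈ Sigma0 q0) : (lam q0 z).im = 0 := by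
  rw [lam_im]
  rcases hz.1 with h | h <;> simp [h]

theorem isOpen_Dplus (q0 : ℝ) : IsOpen (Dplus q0) :=
  isOpen_lt continuous_const (((continuous_norm.pow 2).sub continuous_const).mul
    Complex.continuous_im)

theorem isOpen_Dminus (q0 : ℝ) : IsOpen (Dminus q0) :=
  isOpen_lt (((continuous_norm.pow 2).sub continuous_const).mul Complex.continuous_im)
    continuous_const

/-- A vanishing determinant means z² = -|w|², hence |z| = q₀, where the product is zero. -/
theorem regular_of_ne_zero {q0 : ℝ} {w z : ℂ} (hw : ‖w‖ = q0)
    (hz : (‖z‖ ^ 2 - q0 ^ 2) * z.im ≠ 0) :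
    z ≠ 0 ∧ 1 + w * starRingEnd ℂ w / z ^ 2 ≠ 0 := by
  have hz0 : z ≠ 0 := by
    rintro rfl
    simp at hz
  refine ⟨hz0, fun h => hz ?_⟩
  have h2 : z ^ 2 = -(w * starRingEnd ℂ w) := by
    have hzz : z ^ 2 ≠ 0 := pow_ne_zero 2 hz0
    field_simp at h
    linear_combination h
  have h3 := congrArg norm h2
  rw [norm_pow, norm_neg, norm_mul, Complex.norm_conj, hw] at h3
  rw [h3]
  ring

end HDNLS

end

theorem theorem2p2 (q : ℝ → ℝ → ℂ) (qm qp : ℂ) (q0 : ℝ) (hq0 : 0 < q0)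
    (hqm : ‖qm‖ = q0) (hqp : ‖qp‖ = q0) (t : ℝ)
    (hm : IntegrableOn (fun x => q x t - qm) (Iic 0))
    (hp : IntegrableOn (fun x => q x t - qp) (Ici 0)) :
    -- the columns are well defined by their Volterra equations
    ((∀ z ∈ HDNLS.Dplus q0 ∪ HDNLS.Sigma0 q0,
        (∃! v, HDNLS.IsMinusColumn (fun y => q y t) qm q0 z 0 v) ∧
        (∃! v, HDNLS.IsPlusColumn (fun y => q y t) qp q0 z 1 v)) ∧
      (∀ z ∈ HDNLS.Dminus q0 ∪ HDNLS.Sigma0 q0,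
        (∃! v, HDNLS.IsMinusColumn (fun y => q y t) qm q0 z 1 v) ∧
        (∃! v, HDNLS.IsPlusColumn (fun y => q y t) qp q0 z 0 v))) ∧
    -- and analytic in the spectral parameter
    ∀ x : ℝ,
      AnalyticOnNhd ℂ (fun z => (HDNLS.muMinus q qm q0 x t z).col 0) (HDNLS.Dplus q0) ∧
      AnalyticOnNhd ℂ (fun z => (HDNLS.muPlus q qp q0 x t z).col 1) (HDNLS.Dplus q0) ∧
      AnalyticOnNhd ℂ (fun z => (HDNLS.muMinus q qm q0 x t z).col 1) (HDNLS.Dminus q0) ∧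
      AnalyticOnNhd ℂ (fun z => (HDNLS.muPlus q qp q0 x t z).col 0) (HDNLS.Dminus q0) := by
  open HDNLS in
  -- On the right half-line, adding `qm - qp` turns q - q₋ into the integrable q - q₊.
  have hM : LeftIntegrable fun y => q y t - qm :=
    leftIntegrable_of_integrableOn (qm - qp) hm (by simpa using hp)
  have hP : LeftIntegrable fun y => q (-y) t - qp := by
    refine leftIntegrable_of_integrableOn (qp - qm) ?_ ?_
    · have := (integrableOn_comp_neg_iff (f := fun x => q x t - qp) (x := 0)).2 hp
      simpa using this
    · have := (integrableOn_comp_neg_iff (f := fun y => q (-y) t - qm) (x := 0)).1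
        (by simpa using hm)
      simpa using this
  have hl₁ : ∀ z ∈ Dplus q0 ∪ Sigma0 q0, 0 ≤ (lam q0 z).im := fun z hz =>
    hz.elim lam_im_nonneg fun h => (lam_im_eq_zero h).ge
  have hl₂ : ∀ z ∈ Dminus q0 ∪ Sigma0 q0, (lam q0 z).im ≤ 0 := fun z hz =>
    hz.elim lam_im_nonpos fun h => (lam_im_eq_zero h).le
  have s0 : sigmaSign 0 = 1 := rfl
  have s1 : sigmaSign 1 = -1 := rfl
  have hr₁ : ∀ w, ‖w‖ = q0 → ∀ z ∈ Dplus q0, z ≠ 0 ∧ 1 + w * starRingEnd ℂ w / z ^ 2 ≠ 0 :=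
    fun w hw z hz => regular_of_ne_zero hw (ne_of_gt hz)
  have hr₂ : ∀ w, ‖w‖ = q0 → ∀ z ∈ Dminus q0, z ≠ 0 ∧ 1 + w * starRingEnd ℂ w / z ^ 2 ≠ 0 :=
    fun w hw z hz => regular_of_ne_zero hw (ne_of_lt hz)
  refine ⟨⟨fun z hz => ⟨existsUnique_isMinusColumn hM ?_, existsUnique_isPlusColumn hP ?_⟩,
    fun z hz => ⟨existsUnique_isMinusColumn hM ?_, existsUnique_isPlusColumn hP ?_⟩⟩,
    fun x => ⟨?_, ?_, ?_, ?_⟩⟩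
  · simpa [s0] using hl₁ z hz
  · simpa [s1] using hl₁ z hz
  · simpa [s1] using hl₂ z hz
  · simpa [s0] using hl₂ z hz
  · exact analyticOnNhd_muMinus (isOpen_Dplus q0) (fun z hz => (hr₁ qm hqm z hz).1)
      (fun z hz => (hr₁ qm hqm z hz).2) (fun z hz => by simpa [s0] using hl₁ z (.inl hz)) hM x
  · exact analyticOnNhd_muPlus (isOpen_Dplus q0) (fun z hz => (hr₁ qp hqp z hz).1)
      (fun z hz => (hr₁ qp hqp z hz).2) (fun z hz => by simpa [s1] using hl₁ z (.inl hz)) hP x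
  · exact analyticOnNhd_muMinus (isOpen_Dminus q0) (fun z hz => (hr₂ qm hqm z hz).1)
      (fun z hz => (hr₂ qm hqm z hz).2) (fun z hz => by simpa [s1] using hl₂ z (.inl hz)) hM x
  · exact analyticOnNhd_muPlus (isOpen_Dminus q0) (fun z hz => (hr₂ qp hqp z hz).1)
      (fun z hz => (hr₂ qp hqp z hz).2) (fun z hz => by simpa [s0] using hl₂ z (.inl hz)) hP x
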